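/- Consider one-pass streaming algorithms, possibly randomized, for $\ell_\infty$-regression: the rows $(A_i,b_i)$, $i=1,\dots,n$, of a matrix $A\in\mathbb{R}^{n\times d}$ and a vector $b\in\mathbb{R}^n$ arrive one by one, and at the end the algorithm outputs some $x\in\mathbb{R}^d$. Space is the number $s$ of bits of memory that are kept between two rows; the algorithm may depend on $n$ and $d$, has free access to a random string and to the number of rows read, and is not charged for computation. Call $x$ an $\varepsilon\|b\|_\infty$ relative error solution if $$\|Ax-b\|_\infty\le \min_{y\in\mathbb{R}^d}\|Ay-b\|_\infty+\varepsilon\|b\|_\infty .$$ For all $\varepsilon_0\in(0,1)$ and $p>1/2$ there is a constant $c>0$ such that the following holds for all $n\ge 0$, $d\ge 1$, $0<\varepsilon\le\varepsilon_0$ and every set $D\subseteq\mathbb{R}$ that contains $-1,0,1$. If a streaming algorithm with $s$ bits of memory outputs, for every input $(A,b)$ with $n$ rows and all entries in $D$, an $\varepsilon\|b\|_\infty$ relative error solution with probability at least $p$, then $$s\ \ge\ c\cdot\min\{n,\,2^{cd}\}.$$ In other words, $\Omega(\min\{n,2^{\Omega(d)}\})$ bits of space are required, even if the algorithm is randomized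 and the inputs have entries in $\{-1,0,1\}$ only. -/

import Mathlib

open MeasureTheory

/-- The objective `‖A x - b‖_∞` of `ℓ_∞`-regression (the norm on `Fin n → ℝ` is the sup norm). -/
noncomputable def linftyCost {n d : ℕ} (A : Matrix (Fin n) (Fin d) ℝ) (b : Fin n → ℝ)
    (x : Fin d → ℝ) : ℝ :=
  ‖A.mulVec x - b‖

/-- The optimal value `min_x ‖A x - b‖_∞`. -/
noncomputable def linftyOpt {n d : ℕ} (A : Matrix (Fin n) (Fin d) ℝ) (b : Fin n → ℝ) : ℝ :=
  ⨅ x : Fin d → ℝ, linftyCost A b x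

/-- `x` solves `ℓ_∞`-regression for `(A, b)` up to an error of `ε ‖b‖_∞`. -/
def IsLinftySolution {n d : ℕ} (ε : ℝ) (A : Matrix (Fin n) (Fin d) ℝ) (b : Fin n → ℝ)
    (x : Fin d → ℝ) : Prop :=
  linftyCost A b x ≤ linftyOpt A b + ε * ‖b‖

/-- A randomized one-pass streaming algorithm with `s` bits of memory that reads rows
`(a, β) ∈ ℝ^d × ℝ` and outputs a vector of `ℝ^d`.  It has free read access to a random sample
`ω : Ω` and to the number of rows read so far; between two rows it remembers `s` bits only.
Its three functions are arbitrary, so computation time and working memory are not charged. -/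
structure StreamingAlgorithm (Ω : Type*) (d s : ℕ) where
  /-- the initial memory content -/
  init : Ω → (Fin s → Bool)
  /-- the new memory content, after one more row has been read -/
  update : Ω → ℕ → (Fin s → Bool) → (Fin d → ℝ) × ℝ → (Fin s → Bool)
  /-- the output, computed from the memory content at the end of the stream -/
  output : Ω → (Fin s → Bool) → (Fin d → ℝ)

namespace StreamingAlgorithm

variable {Ω : Type*} {d s n : ℕ}

/-- The memory content after the rows `(A_0, b_0), …, (A_{n-1}, b_{n-1})` have been read
in this order. -/
def finalMemory (alg : StreamingAlgorithm Ω d s) (ω : Ω) (A : Matrix (Fin n) (Fin d) ℝ)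
    (b : Fin n → ℝ) : Fin s → Bool :=
  Fin.foldl n (fun m i => alg.update ω i m (A i, b i)) (alg.init ω)

/-- The output of the algorithm on the stream of the rows of `(A, b)`. -/
def run (alg : StreamingAlgorithm Ω d s) (ω : Ω) (A : Matrix (Fin n) (Fin d) ℝ)
    (b : Fin n → ℝ) : Fin d → ℝ :=
  alg.output ω (alg.finalMemory ω A b)

/-- On every input `(A, b)` with `n` rows and with all entries in `D`, the algorithm outputs a
solution of `ℓ_∞`-regression up to error `ε ‖b‖_∞`, with probability at least `p`.  (The
probability is taken as an inner probability; no measurability is required of the algorithm.) -/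
def SolvesLinftyRegression [MeasurableSpace Ω] (alg : StreamingAlgorithm Ω d s) (μ : Measure Ω)
    (n : ℕ) (D : Set ℝ) (ε p : ℝ) : Prop :=
  ∀ (A : Matrix (Fin n) (Fin d) ℝ) (b : Fin n → ℝ), (∀ i j, A i j ∈ D) → (∀ i, b i ∈ D) →
    ∃ E : Set Ω, MeasurableSet E ∧ p ≤ μ.real E ∧
      ∀ ω ∈ E, IsLinftySolution ε A b (alg.run ω A b)

end StreamingAlgorithm

/-! The proof reduces from the index problem: a one-way message about `N` random bits from which any
single one can be recovered with probability `p > 1/2` needs `Ω(N)` bits (`index_lower_bound`). The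
message is the memory after `N` rows. The coordinates form two halves of `K` blocks, each block
indexed by positions and letters of a code whose words rarely agree (`exists_code`). Bit `i` chooses
the half in which row `i` sums the entries at word `i`, with target `0`. To ask for bit `j`, one row
per block sums the entries at word `j` in both halves, with target `1`. Spreading mass along word
`j` in the half not chosen by bit `j` nearly fits everything. In any approximate solution the chosen
half has a small sum, while the `K` query rows make the other sum large. Large `K` thus handles
every `ε₀ < 1`. -/

/-! ### Communication complexity of the index problem -/

/-- The correlation of two bits: `1` if they agree and `-1` otherwise. -/
def bitCorrelation (u v : Bool) : ℝ := if u = v then 1 else -1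

/-- The exponential moment of the correlation of a fixed string with a uniform one. -/
theorem sum_exp_bitCorrelation {N : ℕ} (g : Fin N → Bool) (θ : ℝ) :
    ∑ x : Fin N → Bool, Real.exp (θ * ∑ j, bitCorrelation (g j) (x j)) =
      (2 * Real.cosh θ) ^ N := by
  have h : ∀ u : Bool, ∑ v : Bool, Real.exp (θ * bitCorrelation u v) = 2 * Real.cosh θ := by
    intro u
    rw [Real.cosh_eq]
    cases u <;> simp [bitCorrelation] <;> ring
  simp_rw [Finset.mul_sum, Real.exp_sum]
  rw [← Fintype.prod_sum fun j v => Real.exp (θ * bitCorrelation (g j) v)]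
  simp only [h, Finset.prod_const, Finset.card_univ, Fintype.card_fin]

/-- If `N` bits are compressed to `s` bits, and guesses for the `N` bits are made from the
compressed string, then the average correlation of the guesses with the bits is small. -/
theorem compression_lower_bound {N s : ℕ} (M : (Fin N → Bool) → (Fin s → Bool))
    (g : (Fin s → Bool) → Fin N → Bool) {δ : ℝ} (hδ : 0 ≤ δ)
    (h : 2 ^ N * (N * δ) ≤ ∑ x : Fin N → Bool, ∑ j, bitCorrelation (g (M x) j) (x j)) :
    N * δ ^ 2 / 2 ≤ s * Real.log 2 := by
  have lower : 2 ^ N * Real.exp (N * δ ^ 2) ≤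
      ∑ x : Fin N → Bool, Real.exp (δ * ∑ j, bitCorrelation (g (M x) j) (x j)) := by
    -- Jensen's inequality as a tangent line at `N * δ ^ 2`, a lower bound for the mean exponent.
    have tangent : ∀ y : ℝ, Real.exp (N * δ ^ 2) * (1 - N * δ ^ 2 + y) ≤ Real.exp y := by
      intro y
      have h1 := Real.add_one_le_exp (y - N * δ ^ 2)
      calc Real.exp (N * δ ^ 2) * (1 - N * δ ^ 2 + y)
          ≤ Real.exp (N * δ ^ 2) * Real.exp (y - N * δ ^ 2) := by gcongr; linarith
        _ = Real.exp y := by rw [← Real.exp_add]; ring_nf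
    refine le_trans ?_ (Finset.sum_le_sum fun x _ => tangent _)
    rw [← Finset.mul_sum, Finset.sum_add_distrib, ← Finset.mul_sum, mul_comm]
    gcongr
    simp only [Finset.sum_const, Finset.card_univ, Fintype.card_fun, Fintype.card_bool,
      Fintype.card_fin, nsmul_eq_mul]
    push_cast
    nlinarith [mul_le_mul_of_nonneg_left h hδ]
  have upper : ∑ x : Fin N → Bool, Real.exp (δ * ∑ j, bitCorrelation (g (M x) j) (x j)) ≤
      2 ^ s * (2 * Real.cosh δ) ^ N := by
    -- Summing over all memory contents `m` decouples the guess from `x`.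
    calc _ ≤ ∑ x : Fin N → Bool, ∑ m : Fin s → Bool,
          Real.exp (δ * ∑ j, bitCorrelation (g m j) (x j)) :=
          Finset.sum_le_sum fun x _ => Finset.single_le_sum
            (f := fun m => Real.exp (δ * ∑ j, bitCorrelation (g m j) (x j)))
            (fun m _ => (Real.exp_pos _).le) (Finset.mem_univ (M x))
      _ = _ := by
        rw [Finset.sum_comm]
        simp [sum_exp_bitCorrelation]
  have cosh : (2 * Real.cosh δ) ^ N ≤ 2 ^ N * Real.exp (N * δ ^ 2 / 2) := by
    rw [mul_pow, mul_div_assoc, Real.exp_nat_mul]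
    gcongr
    exact Real.cosh_le_exp_half_sq δ
  have key : Real.exp (N * δ ^ 2 / 2) ≤ 2 ^ s := by
    have h1 : Real.exp (N * δ ^ 2) = Real.exp (N * δ ^ 2 / 2) * Real.exp (N * δ ^ 2 / 2) := by
      rw [← Real.exp_add]; ring_nf
    have h2 := lower.trans (upper.trans (mul_le_mul_of_nonneg_left cosh (by positivity)))
    rw [h1] at h2
    have h3 : (0 : ℝ) < 2 ^ N * Real.exp (N * δ ^ 2 / 2) := by positivity
    refine le_of_mul_le_mul_left ?_ h3
    linarith
  rw [← Real.log_pow]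
  exact (Real.le_log_iff_exp_le (by positivity)).2 key

/-- The one-way communication complexity of the index problem with public randomness. -/
theorem index_lower_bound {Ω : Type*} [MeasurableSpace Ω] (μ : Measure Ω) [IsProbabilityMeasure μ]
    {N s : ℕ} {p : ℝ} (hp : 1 / 2 < p) (M : Ω → (Fin N → Bool) → (Fin s → Bool))
    (g : Ω → (Fin s → Bool) → Fin N → Bool)
    (h : ∀ x j, ∃ E : Set Ω, MeasurableSet E ∧ p ≤ μ.real E ∧ ∀ ω ∈ E, g ω (M ω x) j = x j) :
    N * (2 * p - 1) ^ 2 / 2 ≤ s * Real.log 2 := by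
  choose E hE hpE hg using h
  have integrable : ∀ x j, Integrable (fun ω => 2 * (E x j).indicator (1 : Ω → ℝ) ω - 1) μ :=
    fun x j => (((integrable_const (1 : ℝ)).indicator (hE x j)).const_mul 2).sub
      (integrable_const 1)
  -- Fix a random string that does at least as well as the average; the integrand bounds the
  -- correlation from below.
  obtain ⟨ω, hω⟩ := exists_integral_le (μ := μ)
    (f := fun ω => ∑ x, ∑ j, (2 * (E x j).indicator (1 : Ω → ℝ) ω - 1))
    (integrable_finsetSum _ fun x _ => integrable_finsetSum _ fun j _ => integrable x j)
  refine compression_lower_bound (M ω) (g ω) (by linarith) (le_trans ?_ (hω.trans ?_))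
  · rw [integral_finsetSum _ fun x _ => integrable_finsetSum _ fun j _ => integrable x j]
    have : ∀ x : Fin N → Bool, (N : ℝ) * (2 * p - 1) ≤
        ∫ ω, ∑ j, (2 * (E x j).indicator (1 : Ω → ℝ) ω - 1) ∂μ := by
      intro x
      rw [integral_finsetSum _ fun j _ => integrable x j]
      have : ∀ j, 2 * p - 1 ≤ ∫ ω, (2 * (E x j).indicator (1 : Ω → ℝ) ω - 1) ∂μ := by
        intro j
        have h1 : Integrable ((E x j).indicator (1 : Ω → ℝ)) μ :=
          (integrable_const (1 : ℝ)).indicator (hE x j)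
        rw [integral_sub (h1.const_mul 2) (integrable_const 1), integral_const_mul, integral_indicator_one (hE x j)]
        simp only [integral_const, probReal_univ, smul_eq_mul, mul_one]
        linarith [hpE x j]
      simpa only [Finset.card_univ, Fintype.card_fin, nsmul_eq_mul] using
        Finset.card_nsmul_le_sum Finset.univ _ _ fun j _ => this j
    simpa using Finset.card_nsmul_le_sum Finset.univ _ _ fun x _ => this x
  · refine Finset.sum_le_sum fun x _ => Finset.sum_le_sum fun j _ => ?_
    by_cases hm : ω ∈ E x j
    · simp [hm, bitCorrelation, hg x j ω hm]; norm_num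
    · simp only [hm, not_false_eq_true, Set.indicator_of_notMem, bitCorrelation]
      split_ifs <;> norm_num

/-! ### Codes with small agreement -/

/-- The number of positions in which two words agree. -/
def agreement {L q : ℕ} (f g : Fin L → Fin q) : ℕ := (Finset.univ.filter fun l => f l = g l).card

/-- Few words agree with a given word in at least a `1/a` fraction of the positions, if the
alphabet has `4 ^ a` letters. -/
theorem card_agreement_ge (a L : ℕ) (g : Fin L → Fin (4 ^ a)) :
    (Finset.univ.filter fun f => L ≤ a * agreement f g).card * 2 ^ L ≤ (4 ^ a) ^ L := by
  -- The moment factors over positions; each factor is `(q - 1) + q` with `q = 4 ^ a`.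
  have moment : ∑ f : Fin L → Fin (4 ^ a), (4 ^ a) ^ agreement f g ≤ (2 * 4 ^ a) ^ L := by
    have h1 : ∀ f : Fin L → Fin (4 ^ a), (4 ^ a) ^ agreement f g =
        ∏ l, if f l = g l then 4 ^ a else 1 := by
      intro f
      rw [Finset.prod_ite, Finset.prod_const_one, mul_one, Finset.prod_const, agreement]
    have h2 : ∀ u : Fin (4 ^ a), ∑ v, (if v = u then 4 ^ a else 1) ≤ 2 * 4 ^ a := by
      intro u
      calc ∑ v, (if v = u then 4 ^ a else 1)
          ≤ ∑ v : Fin (4 ^ a), ((if v = u then 4 ^ a else 0) + 1) :=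
            Finset.sum_le_sum fun v _ => by split_ifs <;> omega
        _ = 2 * 4 ^ a := by
            rw [Finset.sum_add_distrib]; simp; ring
    simp_rw [h1]
    rw [← Fintype.prod_sum fun l v => if v = g l then 4 ^ a else 1]
    simpa using Finset.prod_le_prod' fun l (_ : l ∈ Finset.univ) => h2 (g l)
  have markov : (Finset.univ.filter fun f => L ≤ a * agreement f g).card * 4 ^ L ≤
      (2 * 4 ^ a) ^ L := by
    refine le_trans ?_ moment
    rw [← smul_eq_mul, ← Finset.sum_const]
    refine (Finset.sum_le_sum fun f hf => ?_).trans
      (Finset.sum_le_sum_of_subset (Finset.subset_univ _))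
    rw [← pow_mul]
    exact Nat.pow_le_pow_right (by norm_num) (Finset.mem_filter.1 hf).2
  have h4 : (4 : ℕ) ^ L = 2 ^ L * 2 ^ L := by rw [← mul_pow]; norm_num
  rw [mul_pow, h4] at markov
  refine Nat.le_of_mul_le_mul_left ?_ (pow_pos two_pos L)
  linarith

/-- A code with exponentially many words, any two of which agree in few positions. -/
theorem exists_code (a L N : ℕ) (hN : N ≤ 2 ^ L) :
    ∃ c : Fin N → Fin L → Fin (4 ^ a), ∀ i j, i ≠ j → a * agreement (c i) (c j) < L := by
  induction N with
  | zero => exact ⟨fun i => i.elim0, fun i => i.elim0⟩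
  | succ N ih =>
    obtain ⟨c, hc⟩ := ih (by omega)
    have hcomm : ∀ f g : Fin L → Fin (4 ^ a), agreement f g = agreement g f := by
      intro f g; simp only [agreement, eq_comm]
    obtain ⟨f, hf⟩ : ∃ f, ∀ i, a * agreement f (c i) < L := by
      -- Greedy choice: each earlier word excludes at most a `2 ^ (-L)` fraction of all words, and
      -- there are fewer than `2 ^ L` of them.
      by_contra! hcon
      have hcover : (Finset.univ : Finset (Fin L → Fin (4 ^ a))) ⊆
          Finset.univ.biUnion fun i => Finset.univ.filter fun f => L ≤ a * agreement f (c i) := by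
        intro f _
        simpa using hcon f
      have h1 := (Finset.card_le_card hcover).trans Finset.card_biUnion_le
      have h2 := Nat.mul_le_mul_right (2 ^ L) h1
      rw [Finset.sum_mul] at h2
      have h3 := h2.trans (Finset.sum_le_sum fun i _ => card_agreement_ge a L (c i))
      simp only [Finset.card_univ, Fintype.card_fun, Fintype.card_fin, Finset.sum_const,
        smul_eq_mul] at h3
      have h4 : 0 < (4 ^ a) ^ L := by positivity
      nlinarith
    refine ⟨Fin.cons f c, fun i j => ?_⟩
    refine Fin.cases ?_ (fun i => ?_) i <;> refine Fin.cases ?_ (fun j => ?_) j <;> intro hij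
    · exact absurd rfl hij
    · simpa using hf j
    · rw [hcomm]; simpa using hf i
    · simpa using hc i j (by simpa using hij)

/-! ### From index to regression -/

theorem bddBelow_range_linftyCost {n d : ℕ} (A : Matrix (Fin n) (Fin d) ℝ) (b : Fin n → ℝ) :
    BddBelow (Set.range (linftyCost A b)) :=
  ⟨0, by rintro _ ⟨x, rfl⟩; exact norm_nonneg _⟩

/-- If some `y` has cost at most `η`, then every residual of an approximate solution is at most
`η + ε`. -/
theorem IsLinftySolution.abs_residual_le {n d : ℕ} {ε η : ℝ} {A : Matrix (Fin n) (Fin d) ℝ}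
    {b : Fin n → ℝ} {z : Fin d → ℝ} (h : IsLinftySolution ε A b z) (hε : 0 ≤ ε) (hη : 0 ≤ η)
    (hb : ∀ i, |b i| ≤ 1) (y : Fin d → ℝ) (hy : ∀ i, |A i ⬝ᵥ y - b i| ≤ η) (i : Fin n) :
    |A i ⬝ᵥ z - b i| ≤ η + ε := by
  have h1 : linftyOpt A b ≤ η :=
    (ciInf_le (bddBelow_range_linftyCost A b) y).trans ((pi_norm_le_iff_of_nonneg hη).2 hy)
  have h2 : ‖b‖ ≤ 1 := (pi_norm_le_iff_of_nonneg zero_le_one).2 hb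
  calc |A i ⬝ᵥ z - b i| ≤ linftyCost A b z := norm_le_pi_norm (A.mulVec z - b) i
    _ ≤ linftyOpt A b + ε * ‖b‖ := h
    _ ≤ η + ε * 1 := by gcongr
    _ = η + ε := by ring

namespace StreamingAlgorithm

/-- A reduction from the index problem to `ℓ_∞`-regression: the `i`-th bit determines the `i`-th
row, the last `r` rows depend on the position `j` that is asked for, and every solution of the
resulting instance reveals the `j`-th bit. -/
theorem lower_bound_of_reduction {Ω : Type*} [MeasurableSpace Ω] {μ : Measure Ω}
    [IsProbabilityMeasure μ] {N r d s : ℕ} {D : Set ℝ} {ε p : ℝ} (hp : 1 / 2 < p)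
    (alg : StreamingAlgorithm Ω d s) (halg : alg.SolvesLinftyRegression μ (N + r) D ε p)
    (first : Fin N → Bool → (Fin d → ℝ) × ℝ) (last : Fin N → Fin r → (Fin d → ℝ) × ℝ)
    (hfirst : ∀ i u, (∀ t, (first i u).1 t ∈ D) ∧ (first i u).2 ∈ D)
    (hlast : ∀ j k, (∀ t, (last j k).1 t ∈ D) ∧ (last j k).2 ∈ D)
    (decode : Fin N → (Fin d → ℝ) → Bool)
    (hdecode : ∀ (x : Fin N → Bool) (j : Fin N) (A : Matrix (Fin (N + r)) (Fin d) ℝ)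
      (b : Fin (N + r) → ℝ),
      (∀ i, (A (i.castAdd r), b (i.castAdd r)) = first i (x i)) →
      (∀ k, (A (k.natAdd N), b (k.natAdd N)) = last j k) →
      ∀ z, IsLinftySolution ε A b z → decode j z = x j) :
    N * (2 * p - 1) ^ 2 / 2 ≤ s * Real.log 2 := by
  let row (x : Fin N → Bool) (j : Fin N) : Fin (N + r) → (Fin d → ℝ) × ℝ :=
    Fin.addCases (fun i => first i (x i)) (last j)
  have hrow : ∀ x j i, (∀ t, (row x j i).1 t ∈ D) ∧ (row x j i).2 ∈ D := by
    intro x j i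
    refine Fin.addCases (fun i => ?_) (fun k => ?_) i
    · simpa [row] using hfirst i (x i)
    · simpa [row] using hlast j k
  refine index_lower_bound μ hp
    (fun ω x => Fin.foldl N (fun m i => alg.update ω i m (first i (x i))) (alg.init ω))
    (fun ω m j => decode j (alg.output ω
      (Fin.foldl r (fun m k => alg.update ω (N + k) m (last j k)) m))) fun x j => ?_
  obtain ⟨E, hE, hpE, hsol⟩ := halg (fun i => (row x j i).1) (fun i => (row x j i).2)
    (fun i => (hrow x j i).1) fun i => (hrow x j i).2
  refine ⟨E, hE, hpE, fun ω hω => ?_⟩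
  rw [← hdecode x j _ _ (by simp [row]) (by simp [row]) _ (hsol ω hω)]
  have hcastLE : ∀ i : Fin N, row x j (i.castLE (Nat.le_add_right N r)) = first i (x i) :=
    fun i => Fin.addCases_left i
  have hnatAdd : ∀ k : Fin r, row x j (k.natAdd N) = last j k := fun k => Fin.addCases_right k
  simp only [run, finalMemory, Fin.foldl_add, Prod.mk.eta, hcastLE, hnatAdd, Fin.val_castLE,
    Fin.val_natAdd]

end StreamingAlgorithm

/-- A linear form on an embedded set of coordinates. -/
theorem extend_dotProduct {ι κ : Type*} [Fintype ι] [Fintype κ] (e : ι ↪ κ) (v : ι → ℝ)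
    (z : κ → ℝ) : Function.extend e v 0 ⬝ᵥ z = ∑ t, v t * z (e t) := by
  classical
  rw [dotProduct, ← Finset.sum_subset (Finset.subset_univ (Finset.univ.map e)), Finset.sum_map]
  · simp [e.injective.extend_apply]
  · intro x _ hx
    rw [Function.extend_apply' _ _ _ (by simpa using hx)]
    simp

/-! ### The hard instance -/

section HardInstance

variable {K L q : ℕ}

/-- The indicator of the word `f` in all `K` blocks of the half `u`. -/
def wordIndicator (K : ℕ) (f : Fin L → Fin q) (u : Bool) : Bool × Fin K × Fin L × Fin q → ℝ :=
  fun t => if u = t.1 then if f t.2.2.1 = t.2.2.2 then 1 else 0 else 0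

/-- The indicator of the word `f` in the `k`-th blocks of both halves. -/
def blockIndicator (f : Fin L → Fin q) (k : Fin K) : Bool × Fin K × Fin L × Fin q → ℝ :=
  fun t => if k = t.2.1 then if f t.2.2.1 = t.2.2.2 then 1 else 0 else 0

theorem sum_wordIndicator_mul (f : Fin L → Fin q) (u : Bool)
    (z : Bool × Fin K × Fin L × Fin q → ℝ) :
    ∑ t, wordIndicator K f u t * z t = ∑ k, ∑ l, z (u, k, l, f l) := by
  simp only [Fintype.sum_prod_type, wordIndicator, ite_mul, one_mul, zero_mul]
  cases u <;> simp

theorem sum_blockIndicator_mul (f : Fin L → Fin q) (k : Fin K)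
    (z : Bool × Fin K × Fin L × Fin q → ℝ) :
    ∑ t, blockIndicator f k t * z t = ∑ l, z (true, k, l, f l) + ∑ l, z (false, k, l, f l) := by
  simp only [Fintype.sum_prod_type, blockIndicator, ite_mul, one_mul, zero_mul]
  have h : ∀ u, (∑ k', ∑ l, ∑ t, if k = k' then if f l = t then z (u, k', l, t) else 0 else 0) =
      ∑ l, z (u, k, l, f l) := by
    intro u
    rw [Finset.sum_eq_single k (fun k' _ hk' => by simp [hk'.symm]) (by simp)]
    simp
  rw [Fintype.sum_bool, h, h]

end HardInstance

namespace StreamingAlgorithm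

/-- The hard instance: a bit `x i` is stored as a row that forces the entries of the solution at
the word `c i` in one half of the coordinates to sum to about `0`, whereas the last rows force the
entries at the word `c j` in both halves to have a large sum. -/
theorem lower_bound_of_code {Ω : Type*} [MeasurableSpace Ω] {μ : Measure Ω}
    [IsProbabilityMeasure μ] {N r d s K L q : ℕ} {D : Set ℝ} {ε η p : ℝ} (hp : 1 / 2 < p)
    (hε : 0 ≤ ε) (hη : 0 ≤ η) (hK : 2 * (η + ε) < K * (1 - (η + ε))) (hKr : K ≤ r) (hL : 1 ≤ L)
    (h0 : 0 ∈ D) (h1 : 1 ∈ D) (c : Fin N → Fin L → Fin q)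
    (hc : ∀ i j, i ≠ j → (K * agreement (c i) (c j) : ℝ) ≤ η * L)
    (e : Bool × Fin K × Fin L × Fin q ↪ Fin d)
    (alg : StreamingAlgorithm Ω d s) (halg : alg.SolvesLinftyRegression μ (N + r) D ε p) :
    N * (2 * p - 1) ^ 2 / 2 ≤ s * Real.log 2 := by
  have hLpos : (0 : ℝ) < L := by exact_mod_cast hL
  have hextend : ∀ v : Bool × Fin K × Fin L × Fin q → ℝ, (∀ t, v t ∈ D) →
      ∀ t, Function.extend e v 0 t ∈ D := by
    intro v hv t
    by_cases ht : ∃ a, e a = t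
    · obtain ⟨a, rfl⟩ := ht
      rw [e.injective.extend_apply]
      exact hv a
    · rw [Function.extend_apply' _ _ _ ht]
      exact h0
  let total (j : Fin N) (z : Fin d → ℝ) (u : Bool) : ℝ := ∑ k, ∑ l, z (e (u, k, l, c j l))
  refine lower_bound_of_reduction hp alg halg
    (fun i u => (Function.extend e (wordIndicator K (c i) u) 0, 0))
    -- Zero rows pad the query when `r > K`.
    (fun j k => if h : (k : ℕ) < K then
      (Function.extend e (blockIndicator (c j) ⟨k, h⟩) 0, 1) else (0, 0))
    (fun i u => ⟨hextend _ fun t => ?_, h0⟩) (fun j k => ?_)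
    (fun j z => decide (total j z true < total j z false)) ?_
  · simp only [wordIndicator]
    split_ifs <;> assumption
  · split_ifs with h
    · refine ⟨hextend _ fun t => ?_, h1⟩
      simp only [blockIndicator]
      split_ifs <;> assumption
    · exact ⟨fun _ => h0, h0⟩
  intro x j A b hfirst hlast z hz
  have hA : ∀ i, A (i.castAdd r) = Function.extend e (wordIndicator K (c i) (x i)) 0 :=
    fun i => congrArg Prod.fst (hfirst i)
  have hb : ∀ i : Fin N, b (i.castAdd r) = 0 := fun i => congrArg Prod.snd (hfirst i)
  have hbound : ∀ i, |b i| ≤ 1 := by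
    refine Fin.addCases (fun i => by simp [hb]) fun k => ?_
    have := congrArg Prod.snd (hlast k)
    dsimp only at this
    rw [this]
    split_ifs <;> simp
  -- The witness puts `1 / L` along word `j` in the half opposite to `x j`. Only stored rows of that
  -- half have a residual, namely `K * agreement / L ≤ η`.
  have hres := hz.abs_residual_le hε hη hbound
    (Function.extend e (fun t => wordIndicator K (c j) (!x j) t / L) 0) ?_
  · have hsmall : |total j z (x j)| ≤ η + ε := by
      have := hres (j.castAdd r)
      rwa [hA, hb, extend_dotProduct, sum_wordIndicator_mul _ _ fun t => z (e t), sub_zero] at this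
    have hlarge : K * (1 - (η + ε)) ≤ total j z true + total j z false := by
      have hblock : ∀ k : Fin K, 1 - (η + ε) ≤
          ∑ l, z (e (true, k, l, c j l)) + ∑ l, z (e (false, k, l, c j l)) := by
        intro k
        have hk := hlast ⟨k, k.2.trans_le hKr⟩
        rw [dif_pos k.2] at hk
        have := hres (Fin.natAdd N ⟨k, k.2.trans_le hKr⟩)
        rw [(Prod.mk.inj hk).1, (Prod.mk.inj hk).2, extend_dotProduct,
          sum_blockIndicator_mul _ _ fun t => z (e t)] at this
        linarith [(abs_le.1 this).1]
      have := Finset.card_nsmul_le_sum Finset.univ _ _ fun k _ => hblock k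
      rwa [Finset.sum_add_distrib, Finset.card_univ, Fintype.card_fin, nsmul_eq_mul] at this
    -- By `hK`, the opposite half has total at least `K * (1 - (η + ε)) - (η + ε) > η + ε`.
    have hle := (abs_le.1 hsmall).2
    cases hx : x j
    · rw [hx] at hle
      exact decide_eq_false (by linarith)
    · rw [hx] at hle
      exact decide_eq_true (by linarith)
  · refine Fin.addCases (fun i => ?_) fun k => ?_
    · rw [hA, hb, extend_dotProduct]
      simp only [e.injective.extend_apply]
      rw [sum_wordIndicator_mul, sub_zero]
      by_cases hx : x i = x j
      · simpa [wordIndicator, hx] using hη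
      · have hx' : (!x j) = x i := by cases h : x i <;> cases h' : x j <;> simp_all
        have hij : j ≠ i := fun h => hx (h ▸ rfl)
        simp only [wordIndicator, hx', if_true, ← Finset.sum_div, Finset.sum_boole,
          Finset.sum_const, Finset.card_univ, Fintype.card_fin, nsmul_eq_mul]
        rw [abs_of_nonneg (by positivity), div_le_iff₀ hLpos]
        exact hc j i hij
    · have hk := hlast k
      split_ifs at hk with h
      · rw [(Prod.mk.inj hk).1, (Prod.mk.inj hk).2, extend_dotProduct]
        simp only [e.injective.extend_apply]
        rw [sum_blockIndicator_mul]
        cases x j <;> simpa [wordIndicator, hLpos.ne'] using hη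
      · rw [(Prod.mk.inj hk).1, (Prod.mk.inj hk).2]
        simpa using hη

/-! ### Inputs too small for the code -/

/-- An algorithm that solves `ℓ_∞`-regression on nonempty inputs needs some memory. -/
theorem memory_pos {Ω : Type*} [MeasurableSpace Ω] {μ : Measure Ω} [IsProbabilityMeasure μ]
    {n d s : ℕ} {D : Set ℝ} {ε p : ℝ} (hp : 1 / 2 < p) (hε : 0 ≤ ε) (hε1 : ε < 1)
    (hD : ({-1, 0, 1} : Set ℝ) ⊆ D) (hn : 1 ≤ n) (hd : 1 ≤ d)
    (alg : StreamingAlgorithm Ω d s) (halg : alg.SolvesLinftyRegression μ n D ε p) :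
    1 ≤ s := by
  have hneg : (-1 : ℝ) ∈ D := hD (by simp)
  have h0 : (0 : ℝ) ∈ D := hD (by simp)
  have h1 : (1 : ℝ) ∈ D := hD (by simp)
  obtain ⟨r, rfl⟩ := Nat.exists_eq_add_of_le hn
  let t₀ : Fin d := ⟨0, hd⟩
  -- An index problem with one bit, stored as the sign of the target.
  have key := lower_bound_of_reduction hp alg halg
    (fun _ u => (Pi.single t₀ 1, if u then 1 else -1)) (fun _ _ => (0, 0))
    (fun _ u => ⟨fun t => ?_, ?_⟩) (fun _ _ => ⟨fun _ => h0, h0⟩)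
    (fun _ z => decide (0 < z t₀)) ?_
  · by_contra hs
    obtain rfl : s = 0 := by omega
    have : 0 < (2 * p - 1) ^ 2 := by
      have : 0 < 2 * p - 1 := by linarith
      positivity
    norm_num at key
    linarith
  · dsimp only
    rw [Pi.single_apply]
    split_ifs <;> assumption
  · dsimp only
    split_ifs <;> assumption
  intro x j A b hfirst hlast z hz
  have hA : ∀ i : Fin 1, A (i.castAdd r) = Pi.single t₀ 1 := fun i => congrArg Prod.fst (hfirst i)
  have hb : ∀ i : Fin 1, b (i.castAdd r) = if x i then 1 else -1 :=
    fun i => congrArg Prod.snd (hfirst i)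
  have hA' : ∀ k, A (Fin.natAdd 1 k) = 0 := fun k => congrArg Prod.fst (hlast k)
  have hb' : ∀ k, b (Fin.natAdd 1 k) = 0 := fun k => congrArg Prod.snd (hlast k)
  have hres := hz.abs_residual_le hε le_rfl
    (Fin.addCases (fun i => by rw [hb]; split_ifs <;> simp) fun k => by simp [hb'])
    (Pi.single t₀ (if x 0 then 1 else -1))
    (Fin.addCases (fun i => by simp [hA, hb, Subsingleton.elim i 0]) fun k => by simp [hA', hb'])
    (j.castAdd r)
  rw [hA, hb, single_one_dotProduct, zero_add, abs_le] at hres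
  cases hx : x j
  · simp only [hx, Bool.false_eq_true, if_false] at hres
    exact decide_eq_false (by linarith)
  · simp only [hx, if_true] at hres
    exact decide_eq_true (by linarith)

end StreamingAlgorithm

/-! ### Choice of constants -/

theorem theorem8 (ε₀ p : ℝ) (hε₀ : 0 < ε₀) (hε₀' : ε₀ < 1) (hp : 1 / 2 < p) :
    ∃ c : ℝ, 0 < c ∧
      ∀ (n d s : ℕ) (ε : ℝ) (D : Set ℝ), 1 ≤ d → 0 < ε → ε ≤ ε₀ →
        ({-1, 0, 1} : Set ℝ) ⊆ D →
      ∀ (Ω : Type*) [MeasurableSpace Ω] (μ : Measure Ω) [IsProbabilityMeasure μ]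
        (alg : StreamingAlgorithm Ω d s), alg.SolvesLinftyRegression μ n D ε p →
        c * min (n : ℝ) ((2 : ℝ) ^ (c * (d : ℝ))) ≤ (s : ℝ) := by
  -- With `η = 1 / K` this gives `K * (1 - (η + ε)) ≥ 3`, while `2 * (η + ε) < 2`.
  obtain ⟨K, hK⟩ := exists_nat_ge (4 / (1 - ε₀))
  have hgap : 0 < 1 - ε₀ := by linarith
  rw [div_le_iff₀ hgap] at hK
  have hKpos : (0 : ℝ) < K := pos_of_mul_pos_left (by linarith) hgap.le
  have hK1 : 1 ≤ K := by exact_mod_cast hKpos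
  let q := 4 ^ (K * K)
  have hq : 1 ≤ q := Nat.one_le_pow _ _ (by norm_num)
  let B := 2 * K * q
  have hB : 2 * K ≤ B := Nat.le_mul_of_pos_right _ hq
  have hBK : (2 * K : ℝ) ≤ B := by exact_mod_cast hB
  have hB1 : (1 : ℝ) ≤ B := by
    have : (1 : ℝ) ≤ K := by exact_mod_cast hK1
    linarith
  have hlog := Real.log_pos one_lt_two
  let κ := (2 * p - 1) ^ 2 / (2 * Real.log 2)
  have hκ : 0 < κ := by
    have : 0 < 2 * p - 1 := by linarith
    positivity
  -- The first term pays for `n ≤ 2 * N`; the second gives `c * d ≤ L` and settles small `n` or `d`,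
  -- where `s ≥ 1` suffices.
  let c := min (κ / 2) (1 / (2 * B))
  have hc : 0 < c := by positivity
  have hcκ : c ≤ κ / 2 := min_le_left _ _
  have hcB : c * (2 * B) ≤ 1 := (le_div_iff₀ (by positivity)).1 (min_le_right _ _)
  refine ⟨c, hc, fun n d s ε D hd hε hεle hD Ω _ μ _ alg halg => ?_⟩
  rcases Nat.eq_zero_or_pos n with rfl | hn
  · simp [min_eq_left (Real.rpow_nonneg (zero_le_two (α := ℝ)) (c * d))]
  have hs : (1 : ℝ) ≤ s := by
    exact_mod_cast alg.memory_pos hp hε.le (hεle.trans_lt hε₀') hD hn hd halg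
  by_cases hnK : n < 2 * K
  · have hnK' : (n : ℝ) ≤ 2 * B := by
      have : (n : ℝ) ≤ 2 * K := by exact_mod_cast hnK.le
      linarith
    calc c * min (n : ℝ) ((2 : ℝ) ^ (c * (d : ℝ))) ≤ c * (2 * B) := by
          gcongr
          exact (min_le_left _ _).trans hnK'
      _ ≤ s := hcB.trans hs
  by_cases hdB : d < B
  · have hdB' : c * d ≤ 1 := by
      have : (d : ℝ) ≤ 2 * B := by
        have : (d : ℝ) ≤ B := by exact_mod_cast hdB.le
        linarith
      exact (mul_le_mul_of_nonneg_left this hc.le).trans hcB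
    calc c * min (n : ℝ) ((2 : ℝ) ^ (c * (d : ℝ))) ≤ c * (2 : ℝ) ^ (1 : ℝ) := by
          gcongr
          exact (min_le_right _ _).trans (Real.rpow_le_rpow_of_exponent_le one_le_two hdB')
      _ ≤ c * (2 * B) := by rw [Real.rpow_one]; gcongr; linarith
      _ ≤ s := hcB.trans hs
  push Not at hnK hdB
  let L := d / B
  have hBpos : 0 < B := by omega
  have hL : 1 ≤ L := (Nat.one_le_div_iff hBpos).2 hdB
  have hdL : d ≤ 2 * B * L := by
    have h1 : d < B * (L + 1) := Nat.lt_mul_div_succ d hBpos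
    nlinarith
  -- At least `K` rows remain for the query.
  let N := min (n - K) (2 ^ L)
  have hNn : N ≤ n - K := min_le_left _ _
  obtain ⟨r, hr⟩ : ∃ r, n = N + r := ⟨n - N, by omega⟩
  obtain ⟨w, hw⟩ := exists_code (K * K) L N (min_le_right _ _)
  have hcard : Fintype.card (Bool × Fin K × Fin L × Fin q) ≤ Fintype.card (Fin d) := by
    simp only [Fintype.card_prod, Fintype.card_bool, Fintype.card_fin]
    calc 2 * (K * (L * q)) = B * L := by simp only [B]; ring
      _ ≤ d := Nat.mul_div_le d B
  obtain ⟨e⟩ := Function.Embedding.nonempty_of_card_le hcard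
  have hη : 1 / (K : ℝ) ≤ (1 - ε₀) / 4 := by
    rw [div_le_div_iff₀ hKpos (by norm_num)]
    linarith
  have bound : (N : ℝ) * (2 * p - 1) ^ 2 / 2 ≤ s * Real.log 2 := by
    refine alg.lower_bound_of_code (η := 1 / K) (r := r) (K := K) hp hε.le (by positivity) ?_
      (by omega) hL (hD (by simp)) (hD (by simp)) w (fun i j hij => ?_) e (hr ▸ halg)
    · have h1 : 3 / 4 * (1 - ε₀) ≤ 1 - (1 / K + ε) := by linarith
      have h2 := mul_le_mul_of_nonneg_left h1 hKpos.le
      linarith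
    · have h1 : ((K * K * agreement (w i) (w j) : ℕ) : ℝ) ≤ L := by exact_mod_cast (hw i j hij).le
      push_cast at h1
      rw [one_div_mul_eq_div, le_div_iff₀ hKpos]
      linarith
  have hκN : κ * N ≤ s := by
    have h1 : κ * N = N * (2 * p - 1) ^ 2 / 2 / Real.log 2 := by
      simp only [κ]; field_simp
    rw [h1]
    exact (div_le_iff₀ hlog).2 bound
  have hmin : min (n : ℝ) ((2 : ℝ) ^ (c * (d : ℝ))) ≤ 2 * N := by
    rcases min_choice (n - K) (2 ^ L) with h | h
    · refine (min_le_left _ _).trans ?_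
      have : n ≤ 2 * N := by omega
      exact_mod_cast this
    · refine (min_le_right _ _).trans ?_
      have h1 : c * d ≤ L := by
        calc c * d ≤ c * (2 * B * L) := by
              gcongr
              exact_mod_cast hdL
          _ = c * (2 * B) * L := by ring
          _ ≤ 1 * L := by gcongr
          _ = L := one_mul _
      have h2 : (N : ℝ) = 2 ^ L := by
        simp only [N, h]; push_cast; rfl
      calc (2 : ℝ) ^ (c * (d : ℝ)) ≤ 2 ^ (L : ℝ) :=
            Real.rpow_le_rpow_of_exponent_le one_le_two h1
        _ = N := by rw [Real.rpow_natCast, h2]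
        _ ≤ 2 * N := by linarith [Nat.cast_nonneg (α := ℝ) N]
  calc c * min (n : ℝ) ((2 : ℝ) ^ (c * (d : ℝ))) ≤ κ / 2 * (2 * N) := by gcongr
    _ = κ * N := by ring
    _ ≤ s := hκN
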